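/- For an algebraic number $\alpha$ let $\mathcal H(\alpha)$ denote its height, i.e. the maximum of the absolute values of the coefficients of its primitive minimal polynomial over $\mathbb Z$; for $m\ge 1$ let $\overline{\mathbb Q}_m$ be the set of real algebraic numbers of degree exactly $m$ over $\mathbb{Q}$; and for a rational number $r$ let $\operatorname{den}(r)\ge 1$ be its denominator in lowest terms. A function $\phi:\mathbb R\to\mathbb R$ is called transcendental if the only polynomial $P\in\mathbb C[X,Y]$ with $P(x,\phi(x))=0$ for all $x\in\mathbb R$ is $P=0$. Theorem. For every integer $m\ge 1$ there exist uncountably many transcendental (real-)analytic functions $\phi:\mathbb R\to\mathbb R$ such that $|\phi'(x)|<0.0001$ for all $x\in\mathbb R$, $\phi(\overline{\mathbb Q}_m)\subseteq\mathbb Q$, and, for all $\alpha\in\overline{\mathbb Q}_m$, $$\operatorname{den}(\phi(\alpha))\le (2q)^{450\,m^5\,2^{18m^2}\,q^{6m}},\qquad\text{where } q=\mathcal H(\alpha).$$ -/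

import Mathlib

open Polynomial

/-- The set of real algebraic numbers whose degree over `ℚ` is exactly `m`. -/
def realAlgebraicOfDegree (m : ℕ) : Set ℝ :=
  {α | IsAlgebraic ℚ α ∧ (minpoly ℚ α).natDegree = m}

/-- The primitive minimal polynomial over `ℤ` of an algebraic number `α` (unique up to sign):
clear the denominators of the minimal polynomial over `ℚ` and divide by the content. -/
noncomputable def primitiveMinpoly (α : ℝ) : ℤ[X] :=
  (IsLocalization.integerNormalization (nonZeroDivisors ℤ) (minpoly ℚ α)).primPart

/-- The (naive) height of an algebraic number: the maximum of the absolute values of the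
coefficients of its primitive minimal polynomial over `ℤ`. -/
noncomputable def algebraicHeight (α : ℝ) : ℕ :=
  (primitiveMinpoly α).support.sup fun i => ((primitiveMinpoly α).coeff i).natAbs

/-- A function `f : ℝ → ℝ` is transcendental if the only complex polynomial `P` in two variables
with `P(x, f(x)) = 0` for all real `x` is the null polynomial. -/
def IsTranscendentalFunction (f : ℝ → ℝ) : Prop :=
  ∀ P : ℂ[X][X], (∀ x : ℝ, P.evalEval (x : ℂ) (f x : ℂ) = 0) → P = 0

/-!
Every function is a series `φ = ∑ ε n * newtonFun a n`, where `a` enumerates the real algebraic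
numbers of degree at most `m` by increasing height and `newtonFun a n` vanishes at `a k` for all
`k < n`. Hence `φ (a n)` depends on `ε 0, …, ε n` only, and `ε n` can be chosen, within
`10⁻⁶ / 4 ^ n`, so that this value is a fraction with a given denominator `D n`, provided that
`D n * |newtonFun a n (a n)|` is at least of order `4 ^ n` (`exists_analytic_rat_values`).

* The factors `z / (1 + z ^ 2)` of `newtonFun` are bounded by `2` on the strip `|Im z| ≤ 1 / 2`. So
  the series converges there to a holomorphic function, and Cauchy's estimate makes the derivative
  on the real line as small as required (`newtonSeries_properties`).
* The Gaussian factor gives `|φ x| ≤ exp (-x ^ 2)`. An analytic function with this decay is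
  either zero or transcendental (`isTranscendentalFunction_of_abs_le_exp`): a polynomial relation
  `P (x, φ x) = 0`, once divided by the largest possible power of `φ x`, tends to its term constant
  in `φ x`, and no nonzero polynomial in `x` comes close to zero at infinity.
* The number `D n` only has to exceed the reciprocal of a product of at most `n` factors of the size
  of `|a n - a k|`. There are few factors because few algebraic numbers have bounded height
  (`finite_and_ncard_le_of_algebraicHeight_le`), and none is too small because the norm of a nonzero
  algebraic integer is at least one in absolute value (`one_le_pow_mul_abs_sub`). This leaves the
  allowed power of `2 * algebraicHeight (a n)` (`le_pow_mul_abs_newtonFun`).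
* At every step there are two admissible values for `φ (a n)`. So, given a sequence of functions,
  `φ` can be made to differ from the `n`-th one at `a n`, and no sequence exhausts the set.
-/

/-! ### Newton-type series with rational values at prescribed points -/

/-- The `n`-th function of a Newton-type basis attached to the nodes `a 0, a 1, …`: it vanishes at
`a k` for `k < n`. The usual factor `x - a k` is damped to `(x - a k) / (1 + (x - a k) ^ 2)`, which
is bounded, and the Gaussian makes every function decay faster than any power. -/
noncomputable def newtonFun (a : ℕ → ℝ) (n : ℕ) (x : ℝ) : ℝ :=
  Real.exp (-x ^ 2) * ∏ k ∈ Finset.range n, (x - a k) / (1 + (x - a k) ^ 2)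

/-- The extension of `newtonFun a n` to complex arguments. -/
noncomputable def newtonFunComplex (a : ℕ → ℝ) (n : ℕ) (z : ℂ) : ℂ :=
  Complex.exp (-z ^ 2) * ∏ k ∈ Finset.range n, (z - a k) / (1 + (z - a k) ^ 2)

lemma ofReal_newtonFun (a : ℕ → ℝ) (n : ℕ) (x : ℝ) :
    (newtonFun a n x : ℂ) = newtonFunComplex a n x := by
  simp [newtonFun, newtonFunComplex]

lemma newtonFun_eq_zero (a : ℕ → ℝ) {k n : ℕ} (h : k < n) : newtonFun a n (a k) = 0 := by
  rw [newtonFun, Finset.prod_eq_zero (Finset.mem_range.2 h) (by simp), mul_zero]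

lemma abs_newtonFun_le (a : ℕ → ℝ) (n : ℕ) (x : ℝ) : |newtonFun a n x| ≤ Real.exp (-x ^ 2) := by
  rw [newtonFun, abs_mul, Real.abs_exp, Finset.abs_prod]
  refine mul_le_of_le_one_right (Real.exp_pos _).le
    (Finset.prod_le_one (fun _ _ => abs_nonneg _) fun k _ => ?_)
  rw [abs_div, abs_of_pos (by positivity : (0 : ℝ) < 1 + (x - a k) ^ 2), div_le_one (by positivity)]
  nlinarith [sq_abs (x - a k), sq_nonneg (|x - a k| - 1), abs_nonneg (x - a k)]

lemma three_quarters_add_sq_le_norm_one_add_sq {z : ℂ} (hz : |z.im| ≤ 1 / 2) :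
    3 / 4 + z.re ^ 2 ≤ ‖1 + z ^ 2‖ := by
  refine le_trans ?_ (Complex.re_le_norm _)
  have h := sq_le_sq' (abs_le.1 hz).1 (abs_le.1 hz).2
  simp only [Complex.add_re, Complex.one_re, pow_two, Complex.mul_re] at h ⊢
  linarith

lemma one_add_sq_ne_zero {z : ℂ} (hz : |z.im| ≤ 1 / 2) : 1 + z ^ 2 ≠ 0 := by
  rw [← norm_pos_iff]
  nlinarith [three_quarters_add_sq_le_norm_one_add_sq hz, sq_nonneg z.re]

lemma norm_div_one_add_sq_le {z : ℂ} (hz : |z.im| ≤ 1 / 2) : ‖z / (1 + z ^ 2)‖ ≤ 2 := by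
  have h := three_quarters_add_sq_le_norm_one_add_sq hz
  rw [norm_div, div_le_iff₀ (norm_pos_iff.2 (one_add_sq_ne_zero hz))]
  nlinarith [Complex.norm_le_abs_re_add_abs_im z, sq_abs z.re, sq_nonneg (|z.re| - 1 / 4)]

lemma norm_newtonFunComplex_le (a : ℕ → ℝ) (n : ℕ) {z : ℂ} (hz : |z.im| ≤ 1 / 2) :
    ‖newtonFunComplex a n z‖ ≤ 2 * 2 ^ n := by
  have h := sq_le_sq' (abs_le.1 hz).1 (abs_le.1 hz).2
  rw [newtonFunComplex, norm_mul, norm_prod, Complex.norm_exp]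
  refine mul_le_mul ?_ ?_ (by positivity) (by norm_num)
  · have h1 : (-z ^ 2).re ≤ 1 / 4 := by
      simp only [pow_two, Complex.neg_re, Complex.mul_re] at h ⊢
      nlinarith [sq_nonneg z.re]
    refine (Real.exp_le_exp.2 h1).trans ?_
    rw [← Real.le_log_iff_exp_le (by norm_num)]
    linarith [Real.log_two_gt_d9]
  · refine (Finset.prod_le_prod (fun _ _ => norm_nonneg _) fun k _ =>
      norm_div_one_add_sq_le (z := z - a k) ?_).trans (by simp)
    simpa using hz

lemma differentiableAt_newtonFunComplex (a : ℕ → ℝ) (n : ℕ) {z : ℂ} (hz : |z.im| ≤ 1 / 2) :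
    DifferentiableAt ℂ (newtonFunComplex a n) z := by
  unfold newtonFunComplex
  refine DifferentiableAt.mul (by fun_prop) (DifferentiableAt.fun_finsetProd fun k _ => ?_)
  exact DifferentiableAt.div (by fun_prop) (by fun_prop) (one_add_sq_ne_zero (by simpa using hz))

lemma hasSum_half_pow_mul (c : ℝ) : HasSum (fun n : ℕ => c * (1 / 2) ^ n) (2 * c) := by
  simpa [mul_comm] using hasSum_geometric_two.mul_left c

/-- Since the basis functions grow at most like `2 ^ n` on the strip `|Im z| ≤ 1 / 2`, the series
is holomorphic there, and Cauchy's estimate bounds its derivative on the real line. -/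
lemma newtonSeries_properties (a ε : ℕ → ℝ) (hε : ∀ n, |ε n| ≤ 1 / 10 ^ 6 / 4 ^ n) :
    AnalyticOnNhd ℝ (fun x => ∑' n, ε n * newtonFun a n x) Set.univ ∧
    (∀ x, |deriv (fun x => ∑' n, ε n * newtonFun a n x) x| < 0.0001) ∧
    ∀ x, |∑' n, ε n * newtonFun a n x| ≤ Real.exp (-x ^ 2) := by
  set φ : ℝ → ℝ := fun x => ∑' n, ε n * newtonFun a n x
  set Φ : ℂ → ℂ := fun z => ∑' n, (ε n : ℂ) * newtonFunComplex a n z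
  set U : Set ℂ := {z | |z.im| < 1 / 2}
  have hU : IsOpen U := isOpen_lt (by fun_prop) continuous_const
  have hterm : ∀ n, ∀ z ∈ U,
      ‖(ε n : ℂ) * newtonFunComplex a n z‖ ≤ 2 / 10 ^ 6 * (1 / 2) ^ n := fun n z hz => by
    rw [norm_mul, Complex.norm_real, Real.norm_eq_abs]
    refine (mul_le_mul (hε n) (norm_newtonFunComplex_le a n (le_of_lt hz)) (norm_nonneg _)
      (by positivity)).trans (le_of_eq ?_)
    rw [show (4 : ℝ) = 2 * 2 by norm_num, mul_pow, one_div, one_div, inv_pow]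
    field_simp
  have hbound := hasSum_half_pow_mul (2 / 10 ^ 6)
  have hΦd : DifferentiableOn ℂ Φ U :=
    Complex.differentiableOn_tsum_of_summable_norm hbound.summable
      (fun n z hz => ((differentiableAt_newtonFunComplex a n (le_of_lt hz)).const_mul
        _).differentiableWithinAt) hU hterm
  have hΦb : ∀ z ∈ U, ‖Φ z‖ ≤ 2 * (2 / 10 ^ 6) := fun z hz =>
    tsum_of_norm_bounded hbound fun n => hterm n z hz
  have hφΦ : ∀ x : ℝ, (φ x : ℂ) = Φ x := fun x => by
    simp only [φ, Φ, Complex.ofReal_tsum, Complex.ofReal_mul, ofReal_newtonFun]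
  have hreal : ∀ x : ℝ, (x : ℂ) ∈ U := fun x => by simp [U]
  have hφ : φ = fun x : ℝ => (Φ x).re := funext fun x => by rw [← hφΦ, Complex.ofReal_re]
  refine ⟨?_, fun x => ?_, fun x => ?_⟩
  · intro x _
    have h1 : AnalyticAt ℝ Φ (x : ℂ) := ((hΦd.analyticOnNhd hU) x (hreal x)).restrictScalars
    have h2 : AnalyticAt ℝ (fun x : ℝ => Φ x) x :=
      h1.comp_of_eq (Complex.ofRealCLM.analyticAt x) rfl
    rw [hφ]
    exact (Complex.reCLM.analyticAt _).comp h2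
  · have hd := (hΦd.differentiableAt (hU.mem_nhds (hreal x))).hasDerivAt.real_of_complex
    have hdisc : Metric.closedBall (x : ℂ) (1 / 4) ⊆ U := fun z hz => by
      have := (Complex.abs_im_le_norm (z - x)).trans (mem_closedBall_iff_norm.1 hz)
      simp only [Complex.sub_im, Complex.ofReal_im, sub_zero] at this
      exact this.trans_lt (by norm_num)
    have hC : ‖deriv Φ x‖ ≤ 2 * (2 / 10 ^ 6) / (1 / 4) :=
      Complex.norm_deriv_le_of_forall_mem_sphere_norm_le (by norm_num)
        (hΦd.diffContOnCl_ball hdisc) fun z hz => hΦb z (hdisc (Metric.sphere_subset_closedBall hz))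
    rw [hφ, hd.deriv]
    refine ((Complex.abs_re_le_norm _).trans hC).trans_lt (by norm_num)
  · refine (tsum_of_norm_bounded (hasSum_half_pow_mul (Real.exp (-x ^ 2) / 2))
      fun n => ?_ : ‖φ x‖ ≤ _).trans (le_of_eq (by ring))
    have h4 : 1 / 10 ^ 6 / (4 : ℝ) ^ n ≤ 1 / 2 * (1 / 2) ^ n := by
      rw [show (4 : ℝ) = 2 * 2 by norm_num, mul_pow, one_div_pow]
      have := one_le_pow₀ (M₀ := ℝ) (a := 2) (by norm_num) (n := n)
      rw [div_le_iff₀ (by positivity)]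
      field_simp
      linarith
    rw [norm_mul, Real.norm_eq_abs, Real.norm_eq_abs]
    refine (mul_le_mul ((hε n).trans h4) (abs_newtonFun_le a n x) (abs_nonneg _)
      (by positivity)).trans (le_of_eq (by ring))

/-- An interval of length `2 / D` contains two fractions with denominator `D`, so one of them
avoids any given value. -/
lemma exists_coeff_rat_value {D : ℕ} {w δ : ℝ} (h : 2 ≤ D * (δ * |w|)) (s v : ℝ) :
    ∃ t : ℝ, |t| ≤ δ ∧ s + t * w ≠ v ∧ ∃ r : ℚ, s + t * w = r ∧ r.den ≤ D := by
  have hD : (0 : ℝ) < D := by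
    rcases Nat.eq_zero_or_pos D with rfl | hD
    · norm_num at h
    · exact_mod_cast hD
  have hw : w ≠ 0 := by
    rintro rfl
    norm_num at h
  have key : ∀ k : ℤ, s * D ≤ k → (k : ℝ) ≤ s * D + 2 → (k : ℝ) / D ≠ v →
      ∃ t : ℝ, |t| ≤ δ ∧ s + t * w ≠ v ∧ ∃ r : ℚ, s + t * w = r ∧ r.den ≤ D := by
    intro k h1 h2 h3
    have heq : s + (k / D - s) / w * w = k / D := by field_simp; ring
    refine ⟨(k / D - s) / w, ?_, by rwa [heq], (k : ℚ) / (D : ℚ), by rw [heq]; push_cast; rfl, ?_⟩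
    · rw [abs_div, div_le_iff₀ (abs_pos.2 hw), abs_of_nonneg
        (by rw [sub_nonneg, le_div_iff₀ hD]; exact h1), sub_le_iff_le_add, div_le_iff₀ hD]
      nlinarith
    · have := Rat.den_dvd k D
      rw [Rat.divInt_eq_div] at this
      exact Nat.le_of_dvd (by exact_mod_cast hD) (by exact_mod_cast this)
  have hl := Int.le_ceil (s * D)
  have hr := Int.ceil_lt_add_one (s * D)
  by_cases hv : ((⌈s * D⌉ : ℤ) : ℝ) / D = v
  · refine key (⌈s * D⌉ + 1) (by push_cast; linarith) (by push_cast; linarith) fun hv' => ?_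
    rw [← hv, div_left_inj' hD.ne'] at hv'
    push_cast at hv'
    linarith
  · exact key _ hl (by linarith) hv

/-- The coefficients of the series are chosen one after the other: the value at `a n` involves
only the coefficients up to the `n`-th one, and the latter moves it through an interval of length
of order `|newtonFun a n (a n)| / 4 ^ n`. -/
theorem exists_analytic_rat_values (a : ℕ → ℝ) (D : ℕ → ℕ)
    (hD : ∀ n, 2 * 10 ^ 6 * 4 ^ n ≤ D n * |newtonFun a n (a n)|) (v : ℕ → ℝ) :
    ∃ φ : ℝ → ℝ, AnalyticOnNhd ℝ φ Set.univ ∧ (∀ x, |deriv φ x| < 0.0001) ∧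
      (∀ x, |φ x| ≤ Real.exp (-x ^ 2)) ∧
      ∀ n, φ (a n) ≠ v n ∧ ∃ r : ℚ, φ (a n) = r ∧ r.den ≤ D n := by
  have hstep : ∀ (n : ℕ) (s : ℝ), ∃ t : ℝ, |t| ≤ 1 / 10 ^ 6 / 4 ^ n ∧
      s + t * newtonFun a n (a n) ≠ v n ∧
      ∃ r : ℚ, s + t * newtonFun a n (a n) = r ∧ r.den ≤ D n := fun n s => by
    refine exists_coeff_rat_value ?_ s (v n)
    have := hD n
    have h4 : (0 : ℝ) < 4 ^ n := by positivity
    rw [div_mul_eq_mul_div, mul_div_assoc', le_div_iff₀ h4]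
    linarith
  choose T hT hTv hTr using hstep
  let Ψ : ℕ → ℝ → ℝ := fun n => Nat.rec (fun _ => 0)
    (fun k ψ x => ψ x + T k (ψ (a k)) * newtonFun a k x) n
  set ε : ℕ → ℝ := fun n => T n (Ψ n (a n))
  have hΨ : ∀ n x, Ψ n x = ∑ k ∈ Finset.range n, ε k * newtonFun a k x := fun n x => by
    induction n with
    | zero => rfl
    | succ n ih => rw [Finset.sum_range_succ, ← ih]
  have hval : ∀ n, ∑' k, ε k * newtonFun a k (a n) = Ψ n (a n) + ε n * newtonFun a n (a n) := by
    intro n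
    rw [hΨ, ← Finset.sum_range_succ]
    refine tsum_eq_sum fun k hk => ?_
    rw [newtonFun_eq_zero a (by simpa using hk), mul_zero]
  obtain ⟨h1, h2, h3⟩ := newtonSeries_properties a ε fun n => hT n _
  refine ⟨_, h1, h2, h3, fun n => ?_⟩
  simp only [hval]
  exact ⟨hTv n _, hTr n _⟩

/-! ### Transcendence of rapidly decaying analytic functions -/

open Filter Topology in
/-- A nonzero complex polynomial stays away from zero at infinity. -/
lemma eq_zero_of_frequently_norm_eval_le {p : ℂ[X]} {u : ℝ → ℝ} (hu : Tendsto u atTop (𝓝 0))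
    (h : ∃ᶠ x : ℝ in atTop, ‖p.eval (x : ℂ)‖ ≤ u x) : p = 0 := by
  by_contra hp
  obtain ⟨c, hc, hpc⟩ : ∃ c > 0, ∀ᶠ x : ℝ in atTop, c < ‖p.eval (x : ℂ)‖ := by
    rcases lt_or_ge 0 p.degree with hd | hd
    · have := p.tendsto_norm_atTop hd (z := fun x : ℝ => (x : ℂ)) (l := atTop)
        (by simpa using tendsto_abs_atTop_atTop)
      exact ⟨1, one_pos, this.eventually_gt_atTop 1⟩
    · rw [eq_C_of_degree_le_zero hd] at hp ⊢
      have h0 : 0 < ‖p.coeff 0‖ := by simpa using hp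
      exact ⟨‖p.coeff 0‖ / 2, by positivity, .of_forall fun x => by simpa using h0⟩
  obtain ⟨x, hx, hx1, hx2⟩ := (h.and_eventually (hpc.and (hu.eventually_lt_const hc))).exists
  linarith

open Filter Topology in
lemma tendsto_pow_mul_exp_neg_sq (n : ℕ) :
    Tendsto (fun x : ℝ => x ^ n * Real.exp (-x ^ 2)) atTop (𝓝 0) := by
  refine squeeze_zero' ?_ ?_ (Real.tendsto_pow_mul_exp_neg_atTop_nhds_zero n)
  · filter_upwards [eventually_ge_atTop 0] with x hx
    positivity
  · filter_upwards [eventually_ge_atTop 1] with x hx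
    gcongr
    nlinarith

open Filter Topology in
lemma tendsto_evalEval_mul_of_abs_le_exp {φ : ℝ → ℝ} (hφ : ∀ x, |φ x| ≤ Real.exp (-x ^ 2))
    (P : ℂ[X][X]) :
    Tendsto (fun x : ℝ => P.evalEval (x : ℂ) (φ x : ℂ) * (φ x : ℂ)) atTop (𝓝 0) := by
  have key : ∀ p : ℂ[X], Tendsto (fun x : ℝ => p.eval (x : ℂ) * (φ x : ℂ)) atTop (𝓝 0) := by
    intro p
    induction p using Polynomial.induction_on' with
    | add p q hp hq => simpa [add_mul] using hp.add hq
    | monomial n c =>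
      refine squeeze_zero_norm' ?_ (by simpa using (tendsto_pow_mul_exp_neg_sq n).const_mul ‖c‖)
      filter_upwards [eventually_ge_atTop 0] with x hx
      simp only [eval_monomial, norm_mul, norm_pow, Complex.norm_real, Real.norm_eq_abs,
        abs_of_nonneg hx, mul_assoc]
      gcongr
      exact hφ x
  induction P using Polynomial.induction_on' with
  | add P Q hP hQ => simpa [add_mul] using hP.add hQ
  | monomial n p =>
    refine squeeze_zero_norm (fun x => ?_) (tendsto_zero_iff_norm_tendsto_zero.1 (key p))
    have h1 : |φ x| ≤ 1 := (hφ x).trans (Real.exp_le_one_iff.2 (by nlinarith [sq_nonneg x]))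
    simp only [evalEval, eval_monomial, eval_mul, eval_pow, eval_C, norm_mul, norm_pow,
      Complex.norm_real, Real.norm_eq_abs]
    gcongr
    exact mul_le_of_le_one_right (norm_nonneg _) (pow_le_one₀ (abs_nonneg _) h1)

open Filter Topology in
/-- Along the points where `φ` does not vanish, the coefficients of a relation `P (x, φ x) = 0` can
be shown to be zero one at a time, starting with the constant one: the rest tends to zero. -/
lemma eq_zero_of_frequently_evalEval_eq_zero {φ : ℝ → ℝ}
    (hφ : ∀ x, |φ x| ≤ Real.exp (-x ^ 2)) (P : ℂ[X][X])
    (hP : ∃ᶠ x : ℝ in atTop, φ x ≠ 0 ∧ P.evalEval (x : ℂ) (φ x : ℂ) = 0) : P = 0 := by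
  induction hd : P.natDegree using Nat.strong_induction_on generalizing P with
  | _ d ih =>
    have hsplit : ∀ x y : ℂ, P.evalEval x y = P.divX.evalEval x y * y + (P.coeff 0).eval x := by
      intro x y
      conv_lhs => rw [← P.divX_mul_X_add]
      simp [evalEval]
    have h0 : P.coeff 0 = 0 := by
      refine eq_zero_of_frequently_norm_eval_le (tendsto_zero_iff_norm_tendsto_zero.1
        (tendsto_evalEval_mul_of_abs_le_exp hφ P.divX)) (hP.mono fun x hx => ?_)
      rw [eq_neg_of_add_eq_zero_right ((hsplit x (φ x)).symm.trans hx.2), norm_neg]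
    have hX : P = P.divX * X := by
      conv_lhs => rw [← P.divX_mul_X_add, h0, C_0, add_zero]
    by_cases hd0 : d = 0
    · rw [eq_C_of_natDegree_eq_zero (hd.trans hd0), h0, C_0]
    · rw [hX, ih _ (by rw [natDegree_divX_eq_natDegree_tsub_one]; omega) P.divX ?_ rfl, zero_mul]
      refine hP.mono fun x hx => ⟨hx.1, ?_⟩
      have h := (hsplit x (φ x)).symm.trans hx.2
      rw [h0, eval_zero, add_zero] at h
      exact (mul_eq_zero.1 h).resolve_right (by exact_mod_cast hx.1)

open Filter Topology in
theorem isTranscendentalFunction_of_abs_le_exp {φ : ℝ → ℝ} (ha : AnalyticOnNhd ℝ φ Set.univ)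
    (h0 : φ ≠ 0) (hφ : ∀ x, |φ x| ≤ Real.exp (-x ^ 2)) : IsTranscendentalFunction φ := by
  intro P hP
  refine eq_zero_of_frequently_evalEval_eq_zero hφ P ?_
  have hfreq : ∃ᶠ x in atTop, φ x ≠ 0 := by
    intro hcon
    simp only [ne_eq, not_not] at hcon
    obtain ⟨M, hM⟩ := eventually_atTop.1 hcon
    refine h0 (ha.eq_of_eventuallyEq (z₀ := M + 1) (fun _ _ => analyticAt_const) ?_)
    filter_upwards [eventually_gt_nhds (lt_add_one M)] with x hx
    exact hM x hx.le
  exact hfreq.mono fun x hx => ⟨hx, hP x⟩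

/-! ### Counting and separating algebraic numbers of bounded height -/

section Height

variable {α : ℝ}

lemma integerNormalization_minpoly_ne_zero (hα : IsAlgebraic ℚ α) :
    IsLocalization.integerNormalization (nonZeroDivisors ℤ) (minpoly ℚ α) ≠ 0 :=
  IsFractionRing.integerNormalization_eq_zero_iff.not.2 (minpoly.ne_zero hα.isIntegral)

lemma primitiveMinpoly_ne_zero : primitiveMinpoly α ≠ 0 :=
  (isPrimitive_primPart _).ne_zero

lemma aeval_primitiveMinpoly (hα : IsAlgebraic ℚ α) : aeval α (primitiveMinpoly α) = 0 :=
  aeval_primPart_eq_zero (integerNormalization_minpoly_ne_zero hα)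
    (IsLocalization.integerNormalization_aeval_eq_zero _ _ (minpoly.aeval ℚ α))

lemma natDegree_primitiveMinpoly_le : (primitiveMinpoly α).natDegree ≤ (minpoly ℚ α).natDegree := by
  rw [primitiveMinpoly, natDegree_primPart]
  exact natDegree_le_iff_coeff_eq_zero.2 fun i hi => notMem_support_iff.1 fun h =>
    notMem_support_iff.2 (coeff_eq_zero_of_natDegree_lt hi)
      (IsLocalization.integerNormalization_support _ _ h)

lemma natAbs_coeff_primitiveMinpoly_le (i : ℕ) :
    ((primitiveMinpoly α).coeff i).natAbs ≤ algebraicHeight α := by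
  by_cases h : i ∈ (primitiveMinpoly α).support
  · exact Finset.le_sup (f := fun i => ((primitiveMinpoly α).coeff i).natAbs) h
  · simp [notMem_support_iff.1 h]

lemma one_le_algebraicHeight : 1 ≤ algebraicHeight α :=
  (Int.natAbs_pos.2 (leadingCoeff_ne_zero.2 primitiveMinpoly_ne_zero)).trans_le
    (natAbs_coeff_primitiveMinpoly_le _)

end Height

lemma norm_le_of_aeval_eq_zero {P : ℤ[X]} (hP : P ≠ 0) {q : ℕ}
    (hq : ∀ i, (P.coeff i).natAbs ≤ q) {z : ℂ} (hz : aeval z P = 0) : ‖z‖ ≤ q + 1 := by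
  have hinj : Function.Injective (algebraMap ℤ ℂ) := Int.cast_injective
  have hroot : (P.map (algebraMap ℤ ℂ)).IsRoot z := by rwa [IsRoot, eval_map_algebraMap]
  have hb := hroot.norm_lt_cauchyBound ((Polynomial.map_ne_zero_iff hinj).2 hP)
  have hcoeff : ∀ i, ‖(P.map (algebraMap ℤ ℂ)).coeff i‖₊ = (P.coeff i).natAbs := fun i => by
    ext
    simp [Int.norm_eq_abs]
  have hlead : 1 ≤ ‖(P.map (algebraMap ℤ ℂ)).leadingCoeff‖₊ := by
    rw [leadingCoeff, natDegree_map_eq_of_injective hinj, hcoeff]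
    exact_mod_cast Int.natAbs_pos.2 (leadingCoeff_ne_zero.2 hP)
  have : cauchyBound (P.map (algebraMap ℤ ℂ)) ≤ q + 1 := by
    refine add_le_add_left (div_le_of_le_mul₀ zero_le zero_le
      (le_trans ?_ (le_mul_of_one_le_right zero_le hlead))) 1
    exact Finset.sup_le fun i _ => by rw [hcoeff]; exact_mod_cast hq i
  exact_mod_cast (hb.le.trans this)

lemma norm_algHom_le {K : Type*} [Field K] [Algebra ℚ K] {P : ℤ[X]} (hP : P ≠ 0) {q : ℕ}
    (hq : ∀ i, (P.coeff i).natAbs ≤ q) {x : K} (hx : aeval x P = 0) (σ : K →ₐ[ℚ] ℂ) :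
    ‖σ x‖ ≤ q + 1 := by
  refine norm_le_of_aeval_eq_zero hP hq ?_
  have : aeval ((σ.restrictScalars ℤ) x) P = 0 := by rw [aeval_algHom_apply, hx, map_zero]
  exact this

/-- A nonzero algebraic integer has norm at least one in absolute value; if all its conjugates are
at most `B ≥ 1`, none of them is smaller than `B⁻¹` to the power of the degree less one. -/
lemma one_le_norm_mul_pow_of_isIntegral {K : Type*} [Field K] [NumberField K] {γ : K}
    (hγ : IsIntegral ℤ γ) (h0 : γ ≠ 0) {B : ℝ} (hB : ∀ σ : K →ₐ[ℚ] ℂ, ‖σ γ‖ ≤ B)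
    (σ : K →ₐ[ℚ] ℂ) : 1 ≤ ‖σ γ‖ * B ^ (Module.finrank ℚ K - 1) := by
  classical
  obtain ⟨N, hN⟩ := IsIntegrallyClosed.isIntegral_iff.1 (Algebra.isIntegral_norm ℚ hγ)
  have hN0 : N ≠ 0 := by
    rintro rfl
    exact Algebra.norm_ne_zero_iff.2 h0 (by rw [← hN, map_zero])
  have hprod : ‖(N : ℂ)‖ = ∏ τ : K →ₐ[ℚ] ℂ, ‖τ γ‖ := by
    rw [← norm_prod, ← Algebra.norm_eq_prod_embeddings, ← hN]
    simp
  have h1 : (1 : ℝ) ≤ ‖(N : ℂ)‖ := by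
    rw [Complex.norm_intCast]
    exact_mod_cast Int.one_le_abs hN0
  rw [hprod, ← Finset.mul_prod_erase _ _ (Finset.mem_univ σ)] at h1
  refine h1.trans (mul_le_mul_of_nonneg_left ?_ (norm_nonneg _))
  refine (Finset.prod_le_prod (fun _ _ => norm_nonneg _) fun τ _ => hB τ).trans (le_of_eq ?_)
  rw [Finset.prod_const, Finset.card_erase_of_mem (Finset.mem_univ _), Finset.card_univ,
    AlgHom.card]

/-- The set of real algebraic numbers whose degree over `ℚ` is at most `m`. -/
def realAlgebraicOfDegreeLE (m : ℕ) : Set ℝ :=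
  {α | IsAlgebraic ℚ α ∧ (minpoly ℚ α).natDegree ≤ m}

open IntermediateField in
/-- Multiplying `α - β` by the two leading coefficients gives an algebraic integer of the
compositum `ℚ(α, β)`, to which the bound for conjugates applies. -/
theorem one_le_pow_mul_abs_sub {m q : ℕ} {α β : ℝ} (hα : α ∈ realAlgebraicOfDegreeLE m)
    (hβ : β ∈ realAlgebraicOfDegreeLE m) (hαq : algebraicHeight α ≤ q)
    (hβq : algebraicHeight β ≤ q) (hne : α ≠ β) :
    1 ≤ (2 * q : ℝ) ^ (3 * m ^ 2) * |α - β| := by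
  obtain ⟨hα, hαm⟩ := hα
  obtain ⟨hβ, hβm⟩ := hβ
  set P := primitiveMinpoly α
  set Q := primitiveMinpoly β
  have hP : ∀ i, (P.coeff i).natAbs ≤ q := fun i => (natAbs_coeff_primitiveMinpoly_le i).trans hαq
  have hQ : ∀ i, (Q.coeff i).natAbs ≤ q := fun i => (natAbs_coeff_primitiveMinpoly_le i).trans hβq
  have hq1 : (1 : ℝ) ≤ q := by exact_mod_cast one_le_algebraicHeight.trans hαq
  have := adjoin.finiteDimensional hα.isIntegral
  have := adjoin.finiteDimensional hβ.isIntegral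
  let K : IntermediateField ℚ ℝ := ℚ⟮α⟯ ⊔ ℚ⟮β⟯
  have hfd : FiniteDimensional ℚ K := IntermediateField.finiteDimensional_sup _ _
  have : NumberField K := ⟨⟩
  have hrank : Module.finrank ℚ K ≤ m ^ 2 := by
    refine (finrank_sup_le _ _).trans ?_
    rw [adjoin.finrank hα.isIntegral, adjoin.finrank hβ.isIntegral, pow_two]
    exact Nat.mul_le_mul hαm hβm
  let x : K := ⟨α, (le_sup_left : ℚ⟮α⟯ ≤ K) (mem_adjoin_simple_self ℚ α)⟩
  let y : K := ⟨β, (le_sup_right : ℚ⟮β⟯ ≤ K) (mem_adjoin_simple_self ℚ β)⟩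
  have hx : aeval x P = 0 := by
    have h : algebraMap K ℝ (aeval x P) = 0 := by
      rw [← aeval_algebraMap_apply]
      exact aeval_primitiveMinpoly hα
    simpa using h
  have hy : aeval y Q = 0 := by
    have h : algebraMap K ℝ (aeval y Q) = 0 := by
      rw [← aeval_algebraMap_apply]
      exact aeval_primitiveMinpoly hβ
    simpa using h
  set a := P.leadingCoeff
  set b := Q.leadingCoeff
  have ha : |(a : ℝ)| ≤ q := by
    have : (a.natAbs : ℝ) ≤ q := by exact_mod_cast hP _
    simpa using this
  have hb : |(b : ℝ)| ≤ q := by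
    have : (b.natAbs : ℝ) ≤ q := by exact_mod_cast hQ _
    simpa using this
  let γ : K := b • (a • x) - a • (b • y)
  have hγ : γ = (a * b : ℤ) * (x - y) := by
    simp only [γ, zsmul_eq_mul]
    push_cast
    ring
  have hint : IsIntegral ℤ γ :=
    ((isIntegral_leadingCoeff_smul P x hx).smul b).sub
      ((isIntegral_leadingCoeff_smul Q y hy).smul a)
  have hxy : x - y ≠ 0 := fun h => hne (congrArg Subtype.val (sub_eq_zero.1 h))
  have hγ0 : γ ≠ 0 := by
    rw [hγ]
    exact mul_ne_zero (Int.cast_ne_zero.2 (mul_ne_zero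
      (leadingCoeff_ne_zero.2 primitiveMinpoly_ne_zero)
      (leadingCoeff_ne_zero.2 primitiveMinpoly_ne_zero))) hxy
  have hσγ : ∀ σ : K →ₐ[ℚ] ℂ, ‖σ γ‖ ≤ q ^ 2 * ‖σ x - σ y‖ := fun σ => by
    rw [hγ, map_mul, map_intCast, map_sub, norm_mul, Complex.norm_intCast]
    refine mul_le_mul_of_nonneg_right ?_ (norm_nonneg _)
    push_cast
    rw [abs_mul, pow_two]
    exact mul_le_mul ha hb (abs_nonneg _) (by positivity)
  have hB : ∀ σ : K →ₐ[ℚ] ℂ, ‖σ γ‖ ≤ (2 * q : ℝ) ^ 3 := fun σ => by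
    have h1 := norm_algHom_le primitiveMinpoly_ne_zero hP hx σ
    have h2 := norm_algHom_le primitiveMinpoly_ne_zero hQ hy σ
    refine (hσγ σ).trans ?_
    have h3 : ‖σ x - σ y‖ ≤ 8 * q := (norm_sub_le _ _).trans (by linarith)
    calc (q : ℝ) ^ 2 * ‖σ x - σ y‖ ≤ q ^ 2 * (8 * q) := by gcongr
      _ = (2 * q : ℝ) ^ 3 := by ring
  let σ : K →ₐ[ℚ] ℂ := (Complex.ofRealAm.restrictScalars ℚ).comp K.val
  have hσ : ‖σ x - σ y‖ = |α - β| := by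
    have : σ x - σ y = ((α - β : ℝ) : ℂ) := by
      rw [Complex.ofReal_sub]
      rfl
    rw [this, Complex.norm_real, Real.norm_eq_abs]
  have hmain := one_le_norm_mul_pow_of_isIntegral hint hγ0 hB σ
  have hpos : 0 < Module.finrank ℚ K := Module.finrank_pos
  have h2q : (1 : ℝ) ≤ 2 * q := by linarith
  calc (1 : ℝ) ≤ ‖σ γ‖ * ((2 * q) ^ 3) ^ (Module.finrank ℚ K - 1) := hmain
    _ ≤ (q ^ 2 * |α - β|) * ((2 * q) ^ 3) ^ (Module.finrank ℚ K - 1) := by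
        rw [← hσ]
        gcongr
        exact hσγ σ
    _ ≤ ((2 * q) ^ 3 * |α - β|) * ((2 * q) ^ 3) ^ (Module.finrank ℚ K - 1) := by
        gcongr
        nlinarith [mul_le_mul hq1 hq1 zero_le_one (by positivity)]
    _ = ((2 * q) ^ 3) ^ (Module.finrank ℚ K - 1 + 1) * |α - β| := by ring
    _ = (2 * q) ^ (3 * Module.finrank ℚ K) * |α - β| := by
        rw [Nat.sub_add_cancel hpos, pow_mul]
    _ ≤ (2 * q) ^ (3 * m ^ 2) * |α - β| := by gcongr

/-- The real numbers of degree at most `m` and height at most `q` are roots of one of the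
`(2 * q + 1) ^ (m + 1)` integer polynomials with degree at most `m` and coefficients in `[-q, q]`. -/
theorem finite_and_ncard_le_of_algebraicHeight_le (m q : ℕ) :
    {α ∈ realAlgebraicOfDegreeLE m | algebraicHeight α ≤ q}.Finite ∧
    {α ∈ realAlgebraicOfDegreeLE m | algebraicHeight α ≤ q}.ncard ≤
      m * (2 * q + 1) ^ (m + 1) := by
  classical
  let p : (Fin (m + 1) → ℤ) → ℤ[X] := fun c => ∑ i, C (c i) * X ^ (i : ℕ)
  let T : Finset ℝ := (Fintype.piFinset fun _ : Fin (m + 1) => Finset.Icc (-q : ℤ) q).biUnion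
    fun c => (p c).rootSet ℝ |>.toFinset
  have hsub : {α ∈ realAlgebraicOfDegreeLE m | algebraicHeight α ≤ q} ⊆ (T : Set ℝ) := by
    rintro α ⟨⟨hα, hαm⟩, hαq⟩
    have hp : p (fun i => (primitiveMinpoly α).coeff i) = primitiveMinpoly α := by
      simp only [p]
      rw [Fin.sum_univ_eq_sum_range fun i => C ((primitiveMinpoly α).coeff i) * X ^ i]
      exact (as_sum_range_C_mul_X_pow' _
        (Nat.lt_succ_of_le (natDegree_primitiveMinpoly_le.trans hαm))).symm
    refine Finset.mem_coe.2 (Finset.mem_biUnion.2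
      ⟨fun i => (primitiveMinpoly α).coeff i, Fintype.mem_piFinset.2 fun i => ?_, ?_⟩)
    · have := (natAbs_coeff_primitiveMinpoly_le (α := α) i).trans hαq
      rw [Finset.mem_Icc]
      omega
    · rw [hp, Set.mem_toFinset, mem_rootSet]
      exact ⟨primitiveMinpoly_ne_zero, aeval_primitiveMinpoly hα⟩
  refine ⟨T.finite_toSet.subset hsub, ?_⟩
  refine (Set.ncard_le_ncard hsub T.finite_toSet).trans ?_
  rw [Set.ncard_coe_finset]
  refine (Finset.card_biUnion_le_card_mul _ _ m fun c _ => ?_).trans (le_of_eq ?_)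
  · rw [← Set.ncard_eq_toFinset_card']
    refine (ncard_rootSet_le _ _).trans (natDegree_sum_le_of_forall_le _ _ fun i _ => ?_)
    exact (natDegree_C_mul_X_pow_le _ _).trans (Nat.lt_succ_iff.1 i.2)
  · rw [Fintype.card_piFinset_const, Int.card_Icc, mul_comm]
    congr 2
    omega

lemma infinite_realAlgebraicOfDegreeLE {m : ℕ} (hm : 1 ≤ m) :
    (realAlgebraicOfDegreeLE m).Infinite := by
  refine (Set.infinite_range_of_injective (Nat.cast_injective (R := ℝ))).mono ?_
  rintro _ ⟨k, rfl⟩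
  refine ⟨isAlgebraic_natCast k, hm.trans' (le_of_eq ?_)⟩
  exact minpoly.natDegree_eq_one_iff.2 ⟨k, by simp⟩

/-- An infinite set with finite sublevel sets of `h` can be enumerated along `h`. Ties in `h` are
broken by a linear order, which makes the number of predecessors an injective index; this index is
then relabelled by consecutive natural numbers. -/
theorem exists_enumeration_monotone {ι : Type*} [LinearOrder ι] {A : Set ι} (hA : A.Infinite)
    (h : ι → ℕ) (hfin : ∀ q, {x ∈ A | h x ≤ q}.Finite) :
    ∃ a : ℕ → ι, Function.Injective a ∧ (∀ n, a n ∈ A) ∧ (∀ x ∈ A, ∃ n, a n = x) ∧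
      Monotone (h ∘ a) := by
  let key : ι → ℕ ×ₗ ι := fun x => toLex (h x, x)
  let rank : ι → ℕ := fun x => {y ∈ A | key y < key x}.ncard
  have hkey : ∀ {x y}, key x ≤ key y → h x ≤ h y := fun {x y} hxy => by
    rcases Prod.Lex.le_iff.1 hxy with h | h
    · exact h.le
    · exact h.1.le
  have hrank : ∀ x ∈ A, ∀ y, key x < key y → rank x < rank y := by
    intro x hx y hxy
    refine Set.ncard_lt_ncard ⟨fun z hz => ⟨hz.1, hz.2.trans hxy⟩, fun hss => ?_⟩
      ((hfin (h y)).subset fun z hz => ⟨hz.1, hkey hz.2.le⟩)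
    exact lt_irrefl _ (hss ⟨hx, hxy⟩).2
  have hinj : Set.InjOn rank A := by
    intro x hx y hy hxy
    rcases lt_trichotomy (key x) (key y) with hlt | heq | hlt
    · exact absurd hxy (hrank x hx y hlt).ne
    · exact congrArg (fun z => (ofLex z).2) heq
    · exact absurd hxy (hrank y hy x hlt).ne'
  have hinf : (Set.ofPred fun k => k ∈ rank '' A).Infinite := hA.image hinj
  choose a haA ha using fun n => Nat.nth_mem_of_infinite hinf n
  have hmono : StrictMono fun n => rank (a n) := by
    simp only [ha]
    exact Nat.nth_strictMono hinf
  refine ⟨a, fun i j hij => hmono.injective (congrArg rank hij), haA, fun x hx => ?_, ?_⟩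
  · have hmem : rank x ∈ rank '' A := Set.mem_image_of_mem _ hx
    classical
    refine ⟨Nat.count (fun k => k ∈ rank '' A) (rank x), hinj (haA _) hx ?_⟩
    rw [ha]
    exact Nat.nth_count hmem
  · intro i j hij
    refine hkey (not_lt.1 fun hlt => ?_)
    exact absurd (hrank _ (haA j) _ hlt) (not_lt.2 (hmono.monotone hij))

/-! ### The nodes and the bound for the denominators -/

lemma abs_le_of_algebraicHeight_le {q : ℕ} {α : ℝ} (hα : IsAlgebraic ℚ α)
    (hq : algebraicHeight α ≤ q) : |α| ≤ 2 * q := by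
  have h1 : (1 : ℝ) ≤ q := by exact_mod_cast one_le_algebraicHeight.trans hq
  have h := norm_le_of_aeval_eq_zero (z := α) primitiveMinpoly_ne_zero
    (fun i => (natAbs_coeff_primitiveMinpoly_le i).trans hq)
    (by
      have := aeval_algebraMap_apply ℂ α (primitiveMinpoly α)
      rw [aeval_primitiveMinpoly hα, map_zero] at this
      exact this)
  rw [Complex.norm_real, Real.norm_eq_abs] at h
  linarith

lemma one_le_pow_mul_exp_neg_sq {q : ℕ} (hq : 1 ≤ q) {x : ℝ} (hx : |x| ≤ 2 * q) :
    1 ≤ (2 * q : ℝ) ^ (8 * q ^ 2) * Real.exp (-x ^ 2) := by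
  have h1 : (1 : ℝ) ≤ q := by exact_mod_cast hq
  rw [Real.exp_neg, ← div_eq_mul_inv, one_le_div (Real.exp_pos _)]
  have he : Real.exp 1 ≤ 2 ^ 2 := by linarith [Real.exp_one_lt_d9]
  calc Real.exp (x ^ 2) ≤ Real.exp ((4 * q ^ 2 : ℕ) * 1) := by
        refine Real.exp_le_exp.2 ?_
        push_cast
        nlinarith [sq_abs x, abs_nonneg x]
    _ = Real.exp 1 ^ (4 * q ^ 2) := Real.exp_nat_mul _ _
    _ ≤ (2 ^ 2) ^ (4 * q ^ 2) := by gcongr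
    _ = 2 ^ (8 * q ^ 2) := by rw [← pow_mul]; ring_nf
    _ ≤ (2 * q) ^ (8 * q ^ 2) := by gcongr; linarith

lemma one_le_pow_mul_abs_div {m q : ℕ} (hm : 1 ≤ m) (hq : 1 ≤ q) {d : ℝ} (hd : |d| ≤ 4 * q)
    (hsep : 1 ≤ (2 * q : ℝ) ^ (3 * m ^ 2) * |d|) :
    1 ≤ (2 * q : ℝ) ^ (8 * m ^ 2) * |d / (1 + d ^ 2)| := by
  have h1 : (1 : ℝ) ≤ q := by exact_mod_cast hq
  have hden : 1 + d ^ 2 ≤ (2 * q : ℝ) ^ (5 * m ^ 2) := by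
    calc 1 + d ^ 2 ≤ 32 * (q : ℝ) ^ 2 := by nlinarith [sq_abs d, abs_nonneg d]
      _ ≤ 32 * (q : ℝ) ^ 5 := by gcongr; norm_num
      _ = (2 * q : ℝ) ^ 5 := by ring
      _ ≤ (2 * q : ℝ) ^ (5 * m ^ 2) := by
        gcongr
        · linarith
        · nlinarith
  rw [abs_div, abs_of_pos (by positivity : (0 : ℝ) < 1 + d ^ 2), mul_div_assoc',
    one_le_div (by positivity)]
  calc 1 + d ^ 2 ≤ (2 * q : ℝ) ^ (5 * m ^ 2) * 1 := by rwa [mul_one]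
    _ ≤ (2 * q : ℝ) ^ (5 * m ^ 2) * ((2 * q : ℝ) ^ (3 * m ^ 2) * |d|) := by gcongr
    _ = (2 * q : ℝ) ^ (8 * m ^ 2) * |d| := by rw [← mul_assoc, ← pow_add]; ring_nf

/-- The exponent collects `21` for the factor `2 * 10 ^ 6`, `2 * n` for `4 ^ n`, `8 * q ^ 2` for
the Gaussian and `8 * m ^ 2` for each of the `n` factors of `newtonFun`. -/
lemma exponent_le {m q n : ℕ} (hm : 1 ≤ m) (hq : 1 ≤ q) (hn : n ≤ m * (2 * q + 1) ^ (m + 1)) :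
    21 + 2 * n + 8 * q ^ 2 + 8 * m ^ 2 * n ≤ 450 * m ^ 5 * 2 ^ (18 * m ^ 2) * q ^ (6 * m) := by
  set B := 2 ^ (18 * m ^ 2) * q ^ (6 * m)
  have hcount : (2 * q + 1) ^ (m + 1) ≤ B := by
    calc (2 * q + 1) ^ (m + 1) ≤ (2 ^ 2 * q) ^ (m + 1) := by gcongr; omega
      _ = 2 ^ (2 * (m + 1)) * q ^ (m + 1) := by rw [mul_pow, ← pow_mul]
      _ ≤ B := by
        exact Nat.mul_le_mul (Nat.pow_le_pow_right (by norm_num) (by nlinarith))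
          (Nat.pow_le_pow_right hq (by omega))
  have hq2 : q ^ 2 ≤ B := by
    calc q ^ 2 ≤ q ^ (6 * m) := by gcongr; omega
      _ ≤ B := Nat.le_mul_of_pos_left _ (by positivity)
  have hB : 1 ≤ B := Nat.one_le_iff_ne_zero.2 (by positivity)
  have hnB : n ≤ m * B := hn.trans (by gcongr)
  have hm5 : ∀ k ≤ 5, m ^ k ≤ m ^ 5 := fun k hk => Nat.pow_le_pow_right hm hk
  calc 21 + 2 * n + 8 * q ^ 2 + 8 * m ^ 2 * n
      ≤ 21 * B + 2 * (m * B) + 8 * B + 8 * m ^ 2 * (m * B) := by gcongr; omega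
    _ = (29 * m ^ 0 + 2 * m ^ 1 + 8 * m ^ 3) * B := by ring
    _ ≤ (29 * m ^ 5 + 2 * m ^ 5 + 8 * m ^ 5) * B := by
        gcongr ?_ * B
        linarith [hm5 0 (by norm_num), hm5 1 (by norm_num), hm5 3 (by norm_num)]
    _ ≤ 450 * m ^ 5 * B := by gcongr; omega
    _ = 450 * m ^ 5 * 2 ^ (18 * m ^ 2) * q ^ (6 * m) := by simp only [B]; ring

/-- If the nodes are enumerated by increasing height, then `newtonFun a n (a n)` is not too small
in terms of the height of `a n`: it has few factors, and each of them is bounded below by the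
separation of algebraic numbers. -/
lemma le_pow_mul_abs_newtonFun {m : ℕ} (hm : 1 ≤ m) {a : ℕ → ℝ} (hinj : Function.Injective a)
    (haA : ∀ n, a n ∈ realAlgebraicOfDegreeLE m) (hmono : Monotone (algebraicHeight ∘ a)) (n : ℕ) :
    2 * 10 ^ 6 * 4 ^ n ≤ (2 * algebraicHeight (a n) : ℝ) ^
      (450 * m ^ 5 * 2 ^ (18 * m ^ 2) * algebraicHeight (a n) ^ (6 * m)) *
      |newtonFun a n (a n)| := by
  set q := algebraicHeight (a n)
  have hq : 1 ≤ q := one_le_algebraicHeight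
  have h1 : (1 : ℝ) ≤ q := by exact_mod_cast hq
  have hle : ∀ k ≤ n, algebraicHeight (a k) ≤ q := fun k hk => hmono hk
  have habs : ∀ k ≤ n, |a k| ≤ 2 * q := fun k hk =>
    abs_le_of_algebraicHeight_le (haA k).1 (hle k hk)
  have hn : n ≤ m * (2 * q + 1) ^ (m + 1) := by
    obtain ⟨hfin, hcard⟩ := finite_and_ncard_le_of_algebraicHeight_le m q
    refine le_trans ?_ hcard
    calc n = (a '' Set.Iio n).ncard := by
          rw [Set.ncard_image_of_injective _ hinj, ← Finset.coe_Iio, Set.ncard_coe_finset,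
            Nat.card_Iio]
      _ ≤ _ := Set.ncard_le_ncard (by
          rintro _ ⟨k, hk, rfl⟩
          exact ⟨haA k, hle k (le_of_lt hk)⟩) hfin
  have hfactor : ∀ k ∈ Finset.range n,
      1 ≤ (2 * q : ℝ) ^ (8 * m ^ 2) * |(a n - a k) / (1 + (a n - a k) ^ 2)| := fun k hk => by
    have hk := Finset.mem_range.1 hk
    refine one_le_pow_mul_abs_div hm hq ?_ (one_le_pow_mul_abs_sub (haA n) (haA k) le_rfl
      (hle k hk.le) (hinj.ne hk.ne'))
    linarith [abs_sub (a n) (a k), habs n le_rfl, habs k hk.le]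
  have hprod : 1 ≤ (2 * q : ℝ) ^ (8 * m ^ 2 * n) *
      |∏ k ∈ Finset.range n, (a n - a k) / (1 + (a n - a k) ^ 2)| := by
    have := Finset.prod_le_prod (fun _ _ => zero_le_one) hfactor
    rwa [Finset.prod_const_one, Finset.prod_mul_distrib, Finset.prod_const, Finset.card_range, ← pow_mul,
      ← Finset.abs_prod] at this
  have hexp := one_le_pow_mul_exp_neg_sq hq (habs n le_rfl)
  have hB : (2 : ℝ) ≤ 2 * q := by linarith
  have hconst : 2 * 10 ^ 6 * 4 ^ n ≤ (2 * q : ℝ) ^ (21 + 2 * n) := by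
    calc (2 * 10 ^ 6 * 4 ^ n : ℝ) ≤ 2 ^ 21 * (2 ^ 2) ^ n := by gcongr <;> norm_num
      _ = 2 ^ (21 + 2 * n) := by rw [← pow_mul, ← pow_add]
      _ ≤ (2 * q : ℝ) ^ (21 + 2 * n) := by gcongr
  calc (2 * 10 ^ 6 * 4 ^ n : ℝ) ≤ (2 * q : ℝ) ^ (21 + 2 * n) * (1 * 1) := by rwa [mul_one, mul_one]
    _ ≤ (2 * q : ℝ) ^ (21 + 2 * n) * (((2 * q : ℝ) ^ (8 * q ^ 2) * Real.exp (-a n ^ 2)) *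
        ((2 * q : ℝ) ^ (8 * m ^ 2 * n) *
          |∏ k ∈ Finset.range n, (a n - a k) / (1 + (a n - a k) ^ 2)|)) := by gcongr
    _ = (2 * q : ℝ) ^ (21 + 2 * n + 8 * q ^ 2 + 8 * m ^ 2 * n) * |newtonFun a n (a n)| := by
        rw [newtonFun, abs_mul, Real.abs_exp]
        simp only [pow_add]
        ring
    _ ≤ _ := by
        gcongr
        · linarith
        · exact exponent_le hm hq hn

theorem theorem2 (m : ℕ) (hm : 1 ≤ m) :
    ¬ Set.Countable {φ : ℝ → ℝ |
      AnalyticOnNhd ℝ φ Set.univ ∧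
      IsTranscendentalFunction φ ∧
      (∀ x : ℝ, |deriv φ x| < 0.0001) ∧
      (∀ α ∈ realAlgebraicOfDegree m, ∃ r : ℚ, φ α = (r : ℝ) ∧
        r.den ≤ (2 * algebraicHeight α) ^
          (450 * m ^ 5 * 2 ^ (18 * m ^ 2) * algebraicHeight α ^ (6 * m)))} := by
  intro hcount
  -- Adding the zero function makes the diagonal argument also produce `φ ≠ 0`.
  obtain ⟨f, hf⟩ := (hcount.insert 0).exists_eq_range (Set.insert_nonempty _ _)
  obtain ⟨a, hinj, haA, hsurj, hmono⟩ := exists_enumeration_monotone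
    (infinite_realAlgebraicOfDegreeLE hm) algebraicHeight
    fun q => (finite_and_ncard_le_of_algebraicHeight_le m q).1
  obtain ⟨φ, hana, hderiv, hdecay, hval⟩ := exists_analytic_rat_values a
    (fun n => (2 * algebraicHeight (a n)) ^
      (450 * m ^ 5 * 2 ^ (18 * m ^ 2) * algebraicHeight (a n) ^ (6 * m)))
    (fun n => by
      push_cast
      exact le_pow_mul_abs_newtonFun hm hinj haA hmono n)
    (fun n => f n (a n))
  have hnot : φ ∉ Set.range f := by
    rintro ⟨n, rfl⟩
    exact (hval n).1 rfl
  rw [← hf, Set.mem_insert_iff, not_or] at hnot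
  refine hnot.2 ⟨hana, isTranscendentalFunction_of_abs_le_exp hana hnot.1 hdecay, hderiv, ?_⟩
  intro α hα
  obtain ⟨n, rfl⟩ := hsurj α ⟨hα.1, hα.2.le⟩
  exact (hval n).2
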